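/- Let $0<\alpha\le 2$ and let $S_\alpha$ be a symmetric stable random variable with characteristic function $\mathbb{E}\,e^{\mathrm{i}tS_\alpha}=e^{-|t|^\alpha}$ for all $t\in\mathbb{R}$. Then $S_\alpha\neq 0$ almost surely, and for every complex $s$ with $-1<\operatorname{Re}s<\alpha$ the random variable $|S_\alpha|^s$ is integrable and $$\mathbb{E}|S_\alpha|^s=2^s\,\frac{\Gamma\bigl(\frac{1+s}{2}\bigr)\,\Gamma\bigl(1-\frac{s}{\alpha}\bigr)}{\sqrt{\pi}\,\Gamma\bigl(1-\frac{s}{2}\bigr)}.$$ If $\alpha=1$, then $S_1$ has the Cauchy distribution with density $\frac{1}{\pi(1+x^2)}$, $x\in\mathbb{R}$, and for every complex $s$ with $-1<\operatorname{Re}s<1$ $$\mathbb{E}|S_1|^s=\frac{\Gamma\bigl(\frac{1+s}{2}\bigr)\,\Gamma\bigl(\frac{1-s}{2}\bigr)}{\pi}=\frac{1}{\cos\frac{\pi s}{2}}.$$ -/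

import Mathlib

open MeasureTheory ProbabilityTheory

/-- `S` is a symmetric stable random variable of index `α`: its characteristic function
`t ↦ E e^{itS}` is `e^{-|t|^α}`. -/
def IsSymmetricStable {Ω : Type*} [MeasurableSpace Ω] (S : Ω → ℝ) (α : ℝ) (μ : Measure Ω) :
    Prop :=
  AEMeasurable S μ ∧ ∀ t : ℝ, charFun (μ.map S) t = (Real.exp (-(|t| ^ α)) : ℂ)

/-!
Let `S` and `S'` be independent symmetric stable variables of indices `α` and `β`, and let `E` be a
standard exponential variable independent of them. Since `P (|x| / E ^ (1 / β) < 1 / t)`, which is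
`exp (-|t x| ^ β)`, is the value at `t x` of the characteristic function of `S'`, averaging over `S`
gives `P (|S| / E ^ (1 / β) < 1 / t) = 𝔼 exp (i t S S')`. The right-hand side is symmetric in the
two laws, so `|S| / E ^ (1 / β)` and `|S'| / E ^ (1 / α)` have the same law. Moments of `E` being
values of the Gamma function, comparing `s`-th moments yields
`Γ (1 - s / β) 𝔼 |S| ^ s = Γ (1 - s / α) 𝔼 |S'| ^ s`, where the right-hand side is explicit when
`S'` is Gaussian of variance `2`, for which `β = 2`.
-/

open Set
open scoped FourierTransform NNReal

theorem integral_of_even {E : Type*} [NormedAddCommGroup E] [NormedSpace ℝ E] {f : ℝ → E}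
    (hf : f.Even) : ∫ x, f x = (2 : ℝ) • ∫ x in Ioi 0, f x := by
  by_cases hint : IntegrableOn f (Ioi 0)
  · have hIic : IntegrableOn f (Iic 0) := by
      rw [integrableOn_Iic_iff_integrableOn_Iio]
      simpa only [hf _] using
        IntegrableOn.comp_neg_Iio (c := (0 : ℝ)) (f := f) (by rwa [neg_zero])
    have hreflect : ∫ x in Iic 0, f x = ∫ x in Ioi 0, f x := by
      simpa only [hf _, neg_zero] using integral_comp_neg_Iic 0 f
    rw [← intervalIntegral.integral_Iic_add_Ioi hIic hint, hreflect, two_smul]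
  · rw [integral_undef hint, integral_undef fun h => hint h.integrableOn, smul_zero]

theorem mellin_exp_neg_mul_rpow {b p : ℝ} (hb : 0 < b) (hp : 0 < p) {z : ℂ} (hz : 0 < z.re) :
    mellin (fun x : ℝ => Complex.exp (-(b * (x ^ p : ℝ)))) z =
      (1 / b) ^ (z / p) * Complex.Gamma (z / p) / p := by
  have hre : 0 < (z / p).re := by
    rw [Complex.div_ofReal_re]
    positivity
  rw [mellin_comp_rpow (fun x : ℝ => Complex.exp (-(b * x))), mellin]
  simp only [smul_eq_mul]
  rw [Complex.integral_cpow_mul_exp_neg_mul_Ioi hre hb, abs_of_pos hp, Complex.real_smul,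
    Complex.ofReal_inv, inv_mul_eq_div]

section ExponentialLaw

variable {r : ℝ}

theorem expMeasure_real_Ioi (hr : 0 < r) {c : ℝ} (hc : 0 ≤ c) :
    (expMeasure r).real (Ioi c) = Real.exp (-(r * c)) := by
  have := isProbabilityMeasure_expMeasure hr
  rw [← compl_Iic, probReal_compl_eq_one_sub measurableSet_Iic, ← cdf_eq_real,
    cdf_expMeasure_eq hr, if_pos hc, sub_sub_cancel]

theorem ae_pos_expMeasure (hr : 0 < r) : ∀ᵐ e ∂expMeasure r, 0 < e := by
  have := isProbabilityMeasure_expMeasure hr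
  change Ioi 0 ∈ ae (expMeasure r)
  rw [mem_ae_iff_prob_eq_one measurableSet_Ioi, ← ENNReal.toReal_eq_one_iff]
  change (expMeasure r).real (Ioi 0) = 1
  rw [expMeasure_real_Ioi hr le_rfl, mul_zero, neg_zero, Real.exp_zero]

theorem integral_cpow_expMeasure (hr : 0 < r) {z : ℂ} (hz : -1 < z.re) :
    ∫ e, (e : ℂ) ^ z ∂expMeasure r = (1 / r) ^ z * Complex.Gamma (1 + z) := by
  have hre : 0 < (1 + z).re := by
    rw [Complex.add_re, Complex.one_re]
    linarith
  have hr' : (r : ℂ) ≠ 0 := Complex.ofReal_ne_zero.2 hr.ne'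
  have hpdf (x : ℝ) (hx : x ∈ Ioi 0) : (exponentialPDF r x).toReal • (x : ℂ) ^ z =
      r * ((x : ℂ) ^ (1 + z - 1) * Complex.exp (-(r * x))) := by
    rw [exponentialPDF_of_nonneg hx.le, ENNReal.toReal_ofReal (by positivity), Complex.real_smul,
      add_sub_cancel_left]
    push_cast
    ring
  have hsupport (x : ℝ) (hx : x ∉ Ici 0) : (exponentialPDF r x).toReal • (x : ℂ) ^ z = 0 := by
    rw [exponentialPDF_of_neg (not_le.1 hx), ENNReal.toReal_zero, zero_smul]
  calc ∫ e, (e : ℂ) ^ z ∂expMeasure r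
      = ∫ x, (exponentialPDF r x).toReal • (x : ℂ) ^ z :=
        integral_withDensity_eq_integral_toReal_smul (measurable_gammaPDFReal 1 r).ennreal_ofReal
          (.of_forall fun _ => ENNReal.ofReal_lt_top) _
    _ = ∫ x in Ioi 0, (exponentialPDF r x).toReal • (x : ℂ) ^ z := by
        rw [← setIntegral_eq_integral_of_forall_compl_eq_zero hsupport,
          integral_Ici_eq_integral_Ioi]
    _ = ∫ x : ℝ in Ioi 0, r * ((x : ℂ) ^ (1 + z - 1) * Complex.exp (-(r * x))) :=
        setIntegral_congr_fun measurableSet_Ioi hpdf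
    _ = (1 / r) ^ z * Complex.Gamma (1 + z) := by
        rw [integral_const_mul, Complex.integral_cpow_mul_exp_neg_mul_Ioi hre hr,
          Complex.cpow_add _ _ (one_div_ne_zero hr'), Complex.cpow_one]
        field_simp

end ExponentialLaw

section Gaussian

theorem ofReal_sqrt_pi_ne_zero : (√Real.pi : ℂ) ≠ 0 :=
  Complex.ofReal_ne_zero.2 (Real.sqrt_ne_zero'.2 Real.pi_pos)

theorem integral_abs_cpow_gaussianReal {v : ℝ≥0} (hv : v ≠ 0) {s : ℂ} (hs : -1 < s.re) :
    ∫ x, ((|x| : ℝ) : ℂ) ^ s ∂gaussianReal 0 v =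
      (2 * v) ^ (s / 2) * Complex.Gamma ((1 + s) / 2) / (√Real.pi : ℂ) := by
  have hre : 0 < (1 + s).re := by
    rw [Complex.add_re, Complex.one_re]
    linarith
  have heven : (fun x : ℝ => gaussianPDFReal 0 v x • ((|x| : ℝ) : ℂ) ^ s).Even := fun x => by
    simp only [gaussianPDFReal, sub_zero, neg_sq, abs_neg]
  have hpdf (x : ℝ) (hx : x ∈ Ioi 0) : gaussianPDFReal 0 v x • ((|x| : ℝ) : ℂ) ^ s =
      (√(2 * Real.pi * v) : ℂ)⁻¹ * ((x : ℂ) ^ (1 + s - 1) •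
        Complex.exp (-((1 / (2 * v) : ℝ) * (x ^ (2 : ℝ) : ℝ)))) := by
    rw [gaussianPDFReal, abs_of_pos hx, Complex.real_smul, add_sub_cancel_left, Real.rpow_two,
      sub_zero, smul_eq_mul]
    push_cast
    ring_nf
  have hscale : (2 * v : ℂ) ^ ((1 + s) / 2) = √(2 * v : ℝ) * (2 * v) ^ (s / 2) := by
    rw [add_div, Complex.cpow_add _ _ (by exact_mod_cast (by positivity : 2 * (v : ℝ) ≠ 0)),
      Real.sqrt_eq_rpow, Complex.ofReal_cpow (by positivity)]
    push_cast
    rfl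
  have hsqrt : √(2 * Real.pi * v) = √Real.pi * √(2 * v) := by
    rw [← Real.sqrt_mul Real.pi_pos.le]
    ring_nf
  have hne : (√(2 * v : ℝ) : ℂ) ≠ 0 := Complex.ofReal_ne_zero.2 (by positivity)
  rw [integral_gaussianReal_eq_integral_smul hv, integral_of_even heven,
    setIntegral_congr_fun measurableSet_Ioi hpdf, integral_const_mul, ← mellin,
    mellin_exp_neg_mul_rpow (by positivity) two_pos hre, hsqrt]
  push_cast
  rw [one_div_one_div, hscale, Complex.real_smul]
  push_cast
  field_simp

theorem integrable_abs_cpow_gaussianReal {v : ℝ≥0} (hv : v ≠ 0) {s : ℂ} (hs : -1 < s.re) :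
    Integrable (fun x : ℝ => ((|x| : ℝ) : ℂ) ^ s) (gaussianReal 0 v) := by
  refine .of_integral_ne_zero ?_
  rw [integral_abs_cpow_gaussianReal hv hs]
  have hGamma : Complex.Gamma ((1 + s) / 2) ≠ 0 := Complex.Gamma_ne_zero_of_re_pos <| by
    rw [Complex.div_ofNat_re, Complex.add_re, Complex.one_re]
    linarith
  have hpow : (2 * v : ℂ) ^ (s / 2) ≠ 0 :=
    Complex.cpow_ne_zero_iff.2 (.inl (by exact_mod_cast mul_ne_zero two_ne_zero hv))
  exact div_ne_zero (mul_ne_zero hpow hGamma) ofReal_sqrt_pi_ne_zero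

end Gaussian

section Cauchy

open Complex (I)

theorem integral_cexp_mul_I_sub_mul_abs {b : ℝ} (hb : 0 < b) (a : ℝ) :
    ∫ x : ℝ, Complex.exp (a * x * I - b * |x|) = 2 * b / (a ^ 2 + b ^ 2) := by
  have hIic : EqOn (fun x : ℝ => Complex.exp ((b + a * I) * x))
      (fun x => Complex.exp (a * x * I - b * |x|)) (Iic 0) := fun x hx => by
    simp only [abs_of_nonpos (mem_Iic.1 hx)]
    push_cast
    ring_nf
  have hIoi : EqOn (fun x : ℝ => Complex.exp ((-b + a * I) * x))
      (fun x => Complex.exp (a * x * I - b * |x|)) (Ioi 0) := fun x hx => by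
    simp only [abs_of_pos (mem_Ioi.1 hx)]
    ring_nf
  have hpos : 0 < (b + a * I : ℂ).re := by simpa using hb
  have hneg : (-b + a * I : ℂ).re < 0 := by simpa using hb
  have hfactor : (a ^ 2 + b ^ 2 : ℂ) = (b + a * I) * -(-b + a * I) := by
    linear_combination a ^ 2 * Complex.I_sq
  have hpos' : (b + a * I : ℂ) ≠ 0 := fun h => hpos.ne' (congrArg Complex.re h)
  have hneg' : (-b + a * I : ℂ) ≠ 0 := fun h => hneg.ne (congrArg Complex.re h)
  rw [← intervalIntegral.integral_Iic_add_Ioi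
      ((integrableOn_exp_mul_complex_Iic hpos 0).congr_fun hIic measurableSet_Iic)
      ((integrableOn_exp_mul_complex_Ioi hneg 0).congr_fun hIoi measurableSet_Ioi),
    ← setIntegral_congr_fun measurableSet_Iic hIic, ← setIntegral_congr_fun measurableSet_Ioi hIoi,
    integral_exp_mul_complex_Iic hpos, integral_exp_mul_complex_Ioi hneg, hfactor,
    Complex.ofReal_zero, mul_zero, mul_zero, Complex.exp_zero]
  field_simp
  ring

theorem integrable_cexp_mul_I_sub_mul_abs {b : ℝ} (hb : 0 < b) (a : ℝ) :
    Integrable fun x : ℝ => Complex.exp (a * x * I - b * |x|) := by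
  refine .of_integral_ne_zero ?_
  rw [integral_cexp_mul_I_sub_mul_abs hb]
  exact_mod_cast (by positivity : 2 * b / (a ^ 2 + b ^ 2) ≠ 0)

variable {x₀ : ℝ} {γ : ℝ≥0}

theorem fourier_cexp_mul_I_sub_mul_abs (hγ : γ ≠ 0) (ξ : ℝ) :
    𝓕 (fun x : ℝ => Complex.exp (↑(2 * Real.pi * x₀) * x * I - ↑(2 * Real.pi * γ) * |x|)) ξ =
      cauchyPDFReal x₀ γ ξ := by
  have hcombine (x : ℝ) : Complex.exp (↑(-2 * Real.pi * x * ξ) * I) •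
      Complex.exp (↑(2 * Real.pi * x₀) * x * I - ↑(2 * Real.pi * γ) * |x|) =
        Complex.exp (↑(2 * Real.pi * (x₀ - ξ)) * x * I - ↑(2 * Real.pi * γ) * |x|) := by
    rw [smul_eq_mul, ← Complex.exp_add]
    push_cast
    ring_nf
  simp only [Real.fourier_real_eq_integral_exp_smul, hcombine]
  rw [integral_cexp_mul_I_sub_mul_abs (by positivity), cauchyPDFReal_def]
  have hpi := Complex.ofReal_ne_zero.2 Real.pi_ne_zero
  push_cast
  rw [show (ξ - x₀ : ℂ) ^ 2 = (x₀ - ξ) ^ 2 by ring]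
  simp only [mul_pow]
  rw [← mul_add]
  field_simp

theorem fourierInv_cauchyPDFReal (hγ : γ ≠ 0) (x : ℝ) :
    𝓕⁻ (fun ξ : ℝ => (cauchyPDFReal x₀ γ ξ : ℂ)) x =
      Complex.exp (↑(2 * Real.pi * x₀) * x * I - ↑(2 * Real.pi * γ) * |x|) := by
  have hfourier := funext (fourier_cexp_mul_I_sub_mul_abs (x₀ := x₀) hγ)
  rw [← hfourier, Continuous.fourierInv_fourier_eq (by fun_prop)
    (integrable_cexp_mul_I_sub_mul_abs (by positivity) _)]
  rw [hfourier]
  exact (integrable_cauchyPDFReal x₀).ofReal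

theorem charFun_cauchyMeasure (x₀ : ℝ) (γ : ℝ≥0) (t : ℝ) :
    charFun (cauchyMeasure x₀ γ) t = Complex.exp (t * x₀ * I - γ * |t|) := by
  rcases eq_or_ne γ 0 with rfl | hγ
  · rw [cauchyMeasure_zero_scale, charFun_dirac, RCLike.inner_apply, conj_trivial]
    simp only [Complex.ofReal_mul, NNReal.coe_zero, Complex.ofReal_zero, zero_mul, sub_zero]
  have hphase (x : ℝ) : 2 * Real.pi * inner ℝ x (t / (2 * Real.pi)) = t * x := by
    rw [RCLike.inner_apply, conj_trivial]
    field_simp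
  calc charFun (cauchyMeasure x₀ γ) t
      = ∫ x, (cauchyPDF x₀ γ x).toReal • Complex.exp (t * x * I) := by
        rw [charFun_apply_real, cauchyMeasure_of_scale_ne_zero x₀ hγ,
          integral_withDensity_eq_integral_toReal_smul (measurable_cauchyPDF x₀ γ)
            (.of_forall fun _ => ENNReal.ofReal_lt_top)]
    _ = 𝓕⁻ (fun ξ : ℝ => (cauchyPDFReal x₀ γ ξ : ℂ)) (t / (2 * Real.pi)) := by
        simp only [Real.fourierInv_eq', hphase, cauchyPDF_def, Complex.real_smul, smul_eq_mul,
          ENNReal.toReal_ofReal (cauchyPDF_pos x₀ hγ _).le, Complex.ofReal_mul]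
        simp only [mul_comm]
    _ = Complex.exp (t * x₀ * I - γ * |t|) := by
        have hpi := Complex.ofReal_ne_zero.2 Real.pi_ne_zero
        rw [fourierInv_cauchyPDFReal hγ, abs_div, abs_of_pos Real.two_pi_pos]
        push_cast
        field_simp

end Cauchy

section CharFun

variable {E : Type*} [NormedAddCommGroup E] [InnerProductSpace ℝ E] [MeasurableSpace E]
  [BorelSpace E] [SecondCountableTopology E]

theorem integral_charFun_smul_comm (μ ν : Measure E) [IsFiniteMeasure μ] [IsFiniteMeasure ν]
    (t : ℝ) : ∫ x, charFun μ (t • x) ∂ν = ∫ y, charFun ν (t • y) ∂μ := by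
  simp only [charFun_apply]
  rw [integral_integral_swap]
  · simp only [real_inner_smul_right, real_inner_comm]
  · refine Integrable.of_bound (C := 1) ?_ (.of_forall fun q => ?_)
    · refine Continuous.aestronglyMeasurable ?_
      unfold Function.uncurry
      fun_prop
    · simp only [Function.uncurry, Complex.norm_exp_ofReal_mul_I, le_refl]

end CharFun

/-- The law of `|X| / E ^ (1 / p)`, where `X` has law `ν` and `E` is a standard exponential random
variable independent of `X`. Its distribution function averages `exp (-|t x| ^ p)` over `ν`, so
that equality of two such averages for all `t > 0` becomes an identity in law. -/
noncomputable def expQuotientLaw (p : ℝ) (ν : Measure ℝ) : Measure ℝ :=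
  (ν.prod (expMeasure 1)).map fun q => |q.1| / q.2 ^ p⁻¹

section ExpQuotientLaw

instance isProbabilityMeasure_expMeasure_one : IsProbabilityMeasure (expMeasure 1) :=
  isProbabilityMeasure_expMeasure one_pos

variable {p : ℝ} {ν : Measure ℝ}

theorem measurable_abs_div_rpow (p : ℝ) : Measurable fun q : ℝ × ℝ => |q.1| / q.2 ^ p := by
  fun_prop

instance [IsProbabilityMeasure ν] : IsProbabilityMeasure (expQuotientLaw p ν) :=
  Measure.isProbabilityMeasure_map (measurable_abs_div_rpow _).aemeasurable

theorem expQuotientLaw_real_Iio [IsFiniteMeasure ν] (hp : 0 < p) {r : ℝ} (hr : 0 < r) :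
    (expQuotientLaw p ν).real (Iio r) = ∫ x, Real.exp (-(|x| / r) ^ p) ∂ν := by
  have hset : MeasurableSet {q : ℝ × ℝ | |q.1| / q.2 ^ p⁻¹ < r} :=
    measurableSet_lt (measurable_abs_div_rpow _) measurable_const
  have hslice (x : ℝ) :
      (expMeasure 1).real {e | |x| / e ^ p⁻¹ < r} = Real.exp (-(|x| / r) ^ p) := by
    have hIoi : {e : ℝ | |x| / e ^ p⁻¹ < r} =ᵐ[expMeasure 1] Ioi ((|x| / r) ^ p) := by
      filter_upwards [ae_pos_expMeasure one_pos] with e he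
      refine propext ?_
      change |x| / e ^ p⁻¹ < r ↔ (|x| / r) ^ p < e
      rw [div_lt_comm₀ (by positivity) hr, Real.lt_rpow_inv_iff_of_pos (by positivity) he.le hp]
    rw [measureReal_congr hIoi, expMeasure_real_Ioi one_pos (by positivity), one_mul]
  rw [expQuotientLaw, map_measureReal_apply (measurable_abs_div_rpow _) measurableSet_Iio]
  change ((ν.prod (expMeasure 1)) {q : ℝ × ℝ | |q.1| / q.2 ^ p⁻¹ < r}).toReal = _
  rw [Measure.prod_apply hset, ← integral_toReal]
  · exact integral_congr_ae (.of_forall hslice)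
  · exact (measurable_measure_prodMk_left hset).aemeasurable
  · exact .of_forall fun x => measure_lt_top _ _

theorem ae_prod_expMeasure_snd_pos (ν : Measure ℝ) :
    ∀ᵐ q ∂ν.prod (expMeasure 1), 0 < q.2 :=
  Measure.quasiMeasurePreserving_snd.ae (ae_pos_expMeasure one_pos)

theorem expQuotientLaw_Iio_of_nonpos {r : ℝ} (hr : r ≤ 0) : expQuotientLaw p ν (Iio r) = 0 := by
  rw [expQuotientLaw, Measure.map_apply (measurable_abs_div_rpow _) measurableSet_Iio,
    measure_eq_zero_iff_ae_notMem]
  filter_upwards [ae_prod_expMeasure_snd_pos ν] with q hq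
  exact notMem_Iio.2 (hr.trans (by positivity))

theorem expQuotientLaw_ext {p' : ℝ} {ν' : Measure ℝ} [IsProbabilityMeasure ν]
    [IsProbabilityMeasure ν'] (hp : 0 < p) (hp' : 0 < p')
    (h : ∀ t > 0, ∫ x, Real.exp (-|t * x| ^ p) ∂ν = ∫ x, Real.exp (-|t * x| ^ p') ∂ν') :
    expQuotientLaw p ν = expQuotientLaw p' ν' := by
  refine ext_of_generate_finite (range Iio) (borel_eq_generateFrom_Iio ℝ ▸ BorelSpace.measurable_eq)
    isPiSystem_Iio ?_ (by simp only [measure_univ])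
  rintro _ ⟨r, rfl⟩
  rcases le_or_gt r 0 with hr | hr
  · rw [expQuotientLaw_Iio_of_nonpos hr, expQuotientLaw_Iio_of_nonpos hr]
  · have habs (x : ℝ) : |x| / r = |r⁻¹ * x| := by
      rw [abs_mul, abs_of_pos (inv_pos.2 hr), inv_mul_eq_div]
    rw [← measureReal_eq_measureReal_iff, expQuotientLaw_real_Iio hp hr,
      expQuotientLaw_real_Iio hp' hr]
    simp only [habs]
    exact h r⁻¹ (inv_pos.2 hr)

theorem ae_expQuotientLaw_ne_zero_iff [SFinite ν] :
    (∀ᵐ y ∂expQuotientLaw p ν, y ≠ 0) ↔ ∀ᵐ x ∂ν, x ≠ 0 := by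
  have hset : MeasurableSet {y : ℝ | y ≠ 0} := (measurableSet_singleton 0).compl
  rw [expQuotientLaw, ae_map_iff (measurable_abs_div_rpow _).aemeasurable hset,
    Measure.ae_prod_iff_ae_ae (p := fun q => |q.1| / q.2 ^ p⁻¹ ≠ 0)
      (measurable_abs_div_rpow _ hset)]
  refine Filter.eventually_congr (.of_forall fun x => ?_)
  have hiff : ∀ᵐ e ∂expMeasure 1, |x| / e ^ p⁻¹ ≠ 0 ↔ x ≠ 0 := by
    filter_upwards [ae_pos_expMeasure one_pos] with e he
    rw [div_ne_zero_iff, abs_ne_zero, and_iff_left (Real.rpow_pos_of_pos he _).ne']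
  rw [Filter.eventually_congr hiff, Filter.eventually_const]

theorem abs_div_rpow_inv_cpow {x e : ℝ} (he : 0 < e) (s : ℂ) :
    ((|x| / e ^ p⁻¹ : ℝ) : ℂ) ^ s = ((|x| : ℝ) : ℂ) ^ s * (e : ℂ) ^ (-(s / p)) := by
  rw [div_eq_mul_inv, ← Real.rpow_neg he.le, Complex.ofReal_mul,
    Complex.mul_cpow_ofReal_nonneg (abs_nonneg x) (by positivity),
    ← Complex.cpow_mul_ofReal_nonneg he.le, div_eq_mul_inv, Complex.ofReal_neg, Complex.ofReal_inv,
    neg_mul, mul_comm s]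

theorem cpow_abs_div_rpow_inv_ae_eq (ν : Measure ℝ) (p : ℝ) (s : ℂ) :
    (fun q : ℝ × ℝ => ((|q.1| / q.2 ^ p⁻¹ : ℝ) : ℂ) ^ s) =ᵐ[ν.prod (expMeasure 1)]
      fun q => ((|q.1| : ℝ) : ℂ) ^ s * (q.2 : ℂ) ^ (-(s / p)) := by
  filter_upwards [ae_prod_expMeasure_snd_pos ν] with q hq using abs_div_rpow_inv_cpow hq s

theorem integral_cpow_expQuotientLaw [SFinite ν] (hp : 0 < p) {s : ℂ} (hs : s.re < p) :
    ∫ y, (y : ℂ) ^ s ∂expQuotientLaw p ν =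
      Complex.Gamma (1 - s / p) * ∫ x, ((|x| : ℝ) : ℂ) ^ s ∂ν := by
  have hre : -1 < (-(s / p)).re := by
    rwa [Complex.neg_re, Complex.div_ofReal_re, neg_lt_neg_iff, div_lt_one hp]
  have hmeas : Measurable fun y : ℝ => (y : ℂ) ^ s := by fun_prop
  rw [expQuotientLaw, integral_map (measurable_abs_div_rpow _).aemeasurable
      hmeas.aestronglyMeasurable, integral_congr_ae (cpow_abs_div_rpow_inv_ae_eq ν p s),
    integral_prod_mul (fun x : ℝ => ((|x| : ℝ) : ℂ) ^ s) fun e : ℝ => (e : ℂ) ^ (-(s / p)),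
    integral_cpow_expMeasure one_pos hre, Complex.ofReal_one, div_one,
    Complex.one_cpow, one_mul, ← sub_eq_add_neg, mul_comm]

theorem integrable_cpow_expQuotientLaw_iff [SFinite ν] (hp : 0 < p) {s : ℂ} (hs : s.re < p) :
    Integrable (fun y : ℝ => (y : ℂ) ^ s) (expQuotientLaw p ν) ↔
      Integrable (fun x : ℝ => ((|x| : ℝ) : ℂ) ^ s) ν := by
  have hre : -1 < (-(s / p)).re := by
    rwa [Complex.neg_re, Complex.div_ofReal_re, neg_lt_neg_iff, div_lt_one hp]
  have hmoment : ∫ e, (e : ℂ) ^ (-(s / p)) ∂expMeasure 1 ≠ 0 := by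
    rw [integral_cpow_expMeasure one_pos hre, Complex.ofReal_one, div_one, Complex.one_cpow,
      one_mul]
    exact Complex.Gamma_ne_zero_of_re_pos (by rw [Complex.add_re, Complex.one_re]; linarith)
  have hmeas : Measurable fun y : ℝ => (y : ℂ) ^ s := by fun_prop
  rw [expQuotientLaw, integrable_map_measure hmeas.aestronglyMeasurable
    (measurable_abs_div_rpow _).aemeasurable]
  change Integrable (fun q : ℝ × ℝ => ((|q.1| / q.2 ^ p⁻¹ : ℝ) : ℂ) ^ s) _ ↔ _
  rw [integrable_congr (cpow_abs_div_rpow_inv_ae_eq ν p s)]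
  refine ⟨fun h => ?_, fun h => h.mul_prod (.of_integral_ne_zero hmoment)⟩
  have hleft := h.integral_prod_left
  simp only [integral_const_mul] at hleft
  exact (integrable_mul_const_iff (isUnit_iff_ne_zero.2 hmoment) _).1 hleft

end ExpQuotientLaw

theorem two_cpow_mul_Gamma_one_sub (s : ℂ) :
    2 ^ s * Complex.Gamma (1 - s) * (√Real.pi : ℂ) =
      Complex.Gamma ((1 - s) / 2) * Complex.Gamma (1 - s / 2) := by
  have h := Complex.Gamma_mul_Gamma_add_half ((1 - s) / 2)
  rw [show (1 - s) / 2 + 1 / 2 = 1 - s / 2 by ring, show 2 * ((1 - s) / 2) = 1 - s by ring,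
    sub_sub_cancel] at h
  rw [h]
  ring

theorem Gamma_one_add_div_two_mul_Gamma_one_sub_div_two (s : ℂ) :
    Complex.Gamma ((1 + s) / 2) * Complex.Gamma ((1 - s) / 2) =
      Real.pi / Complex.cos (Real.pi * s / 2) := by
  have h := Complex.Gamma_mul_Gamma_one_sub ((1 + s) / 2)
  rwa [show 1 - (1 + s) / 2 = (1 - s) / 2 by ring,
    show (Real.pi : ℂ) * ((1 + s) / 2) = Real.pi * s / 2 + Real.pi / 2 by ring,
    Complex.sin_add_pi_div_two] at h

theorem Gamma_one_sub_div_two_ne_zero {s : ℂ} (hs : s.re < 2) : Complex.Gamma (1 - s / 2) ≠ 0 :=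
  Complex.Gamma_ne_zero_of_re_pos <| by
    rw [Complex.sub_re, Complex.one_re, Complex.div_ofNat_re]
    linarith

section Stable

/-- `ν` is the symmetric stable law of index `α`: the condition that `IsSymmetricStable S α μ`
imposes on the law `μ.map S`. -/
def IsSymmetricStableLaw (ν : Measure ℝ) (α : ℝ) : Prop :=
  ∀ t : ℝ, charFun ν t = (Real.exp (-(|t| ^ α)) : ℂ)

variable {α β : ℝ} {ν ρ : Measure ℝ} {s : ℂ}

theorem isSymmetricStableLaw_gaussianReal : IsSymmetricStableLaw (gaussianReal 0 2) 2 := by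
  intro t
  rw [charFun_gaussianReal, Real.rpow_two, sq_abs]
  push_cast
  ring_nf

theorem IsSymmetricStableLaw.integral_exp_neg_abs_rpow_comm [IsFiniteMeasure ν] [IsFiniteMeasure ρ]
    (hν : IsSymmetricStableLaw ν α) (hρ : IsSymmetricStableLaw ρ β) (t : ℝ) :
    ∫ x, Real.exp (-|t * x| ^ β) ∂ν = ∫ y, Real.exp (-|t * y| ^ α) ∂ρ := by
  have h := integral_charFun_smul_comm ρ ν t
  simp only [smul_eq_mul, hν _, hρ _] at h
  rw [integral_complex_ofReal, integral_complex_ofReal] at h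
  exact Complex.ofReal_injective h

theorem IsSymmetricStableLaw.expQuotientLaw_comm [IsProbabilityMeasure ν] [IsProbabilityMeasure ρ]
    (hν : IsSymmetricStableLaw ν α) (hρ : IsSymmetricStableLaw ρ β) (hα : 0 < α) (hβ : 0 < β) :
    expQuotientLaw β ν = expQuotientLaw α ρ :=
  expQuotientLaw_ext hβ hα fun t _ => hν.integral_exp_neg_abs_rpow_comm hρ t

theorem IsSymmetricStableLaw.ae_ne_zero [IsProbabilityMeasure ν] (hα : 0 < α)
    (hν : IsSymmetricStableLaw ν α) : ∀ᵐ x ∂ν, x ≠ 0 := by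
  have := nullSingletonClass_gaussianReal (μ := 0) (v := 2) two_ne_zero
  rw [← ae_expQuotientLaw_ne_zero_iff (p := 2),
    hν.expQuotientLaw_comm isSymmetricStableLaw_gaussianReal hα two_pos,
    ae_expQuotientLaw_ne_zero_iff]
  exact Measure.ae_ne _ 0

theorem IsSymmetricStableLaw.integrable_abs_cpow_iff [IsProbabilityMeasure ν]
    [IsProbabilityMeasure ρ] (hν : IsSymmetricStableLaw ν α) (hρ : IsSymmetricStableLaw ρ β)
    (hα : 0 < α) (hβ : 0 < β) (hsα : s.re < α) (hsβ : s.re < β) :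
    Integrable (fun x : ℝ => ((|x| : ℝ) : ℂ) ^ s) ν ↔
      Integrable (fun x : ℝ => ((|x| : ℝ) : ℂ) ^ s) ρ := by
  rw [← integrable_cpow_expQuotientLaw_iff hβ hsβ, hν.expQuotientLaw_comm hρ hα hβ,
    integrable_cpow_expQuotientLaw_iff hα hsα]

theorem IsSymmetricStableLaw.Gamma_mul_integral_abs_cpow_comm [IsProbabilityMeasure ν]
    [IsProbabilityMeasure ρ] (hν : IsSymmetricStableLaw ν α) (hρ : IsSymmetricStableLaw ρ β)
    (hα : 0 < α) (hβ : 0 < β) (hsα : s.re < α) (hsβ : s.re < β) :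
    Complex.Gamma (1 - s / β) * ∫ x, ((|x| : ℝ) : ℂ) ^ s ∂ν =
      Complex.Gamma (1 - s / α) * ∫ y, ((|y| : ℝ) : ℂ) ^ s ∂ρ := by
  rw [← integral_cpow_expQuotientLaw hβ hsβ, hν.expQuotientLaw_comm hρ hα hβ,
    integral_cpow_expQuotientLaw hα hsα]

theorem IsSymmetricStableLaw.integrable_abs_cpow [IsProbabilityMeasure ν]
    (hν : IsSymmetricStableLaw ν α) (hα : 0 < α) (hs : -1 < s.re) (hsα : s.re < α)
    (hs2 : s.re < 2) : Integrable (fun x : ℝ => ((|x| : ℝ) : ℂ) ^ s) ν :=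
  (hν.integrable_abs_cpow_iff isSymmetricStableLaw_gaussianReal hα two_pos hsα hs2).2
    (integrable_abs_cpow_gaussianReal two_ne_zero hs)

theorem IsSymmetricStableLaw.integral_abs_cpow [IsProbabilityMeasure ν]
    (hν : IsSymmetricStableLaw ν α) (hα : 0 < α) (hs : -1 < s.re) (hsα : s.re < α)
    (hs2 : s.re < 2) :
    ∫ x, ((|x| : ℝ) : ℂ) ^ s ∂ν =
      2 ^ s * (Complex.Gamma ((1 + s) / 2) * Complex.Gamma (1 - s / α)) /
        ((√Real.pi : ℂ) * Complex.Gamma (1 - s / 2)) := by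
  have hratio :=
    hν.Gamma_mul_integral_abs_cpow_comm isSymmetricStableLaw_gaussianReal hα two_pos hsα hs2
  have hfour : (2 * (2 : ℝ≥0) : ℂ) ^ (s / 2) = 2 ^ s := by
    have h := Complex.mul_cpow_ofReal_nonneg zero_le_two zero_le_two (s / 2)
    rwa [← Complex.cpow_add _ _ (Complex.ofReal_ne_zero.2 two_ne_zero), add_halves] at h
  rw [integral_abs_cpow_gaussianReal two_ne_zero hs, hfour, Complex.ofReal_ofNat] at hratio
  rw [mul_div_assoc', eq_div_iff ofReal_sqrt_pi_ne_zero] at hratio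
  rw [eq_div_iff (mul_ne_zero ofReal_sqrt_pi_ne_zero (Gamma_one_sub_div_two_ne_zero hs2))]
  linear_combination hratio

theorem isSymmetricStableLaw_cauchyMeasure : IsSymmetricStableLaw (cauchyMeasure 0 1) 1 := by
  intro t
  rw [charFun_cauchyMeasure, Real.rpow_one]
  simp

theorem integral_abs_cpow_cauchyMeasure (hs : -1 < s.re) (hs1 : s.re < 1) :
    ∫ x, ((|x| : ℝ) : ℂ) ^ s ∂cauchyMeasure 0 1 =
      Complex.Gamma ((1 + s) / 2) * Complex.Gamma ((1 - s) / 2) / Real.pi := by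
  have hs2 : s.re < 2 := hs1.trans one_lt_two
  have hpi : (Real.pi : ℂ) = √Real.pi * √Real.pi := by
    rw [← Complex.ofReal_mul, Real.mul_self_sqrt Real.pi_pos.le]
  rw [isSymmetricStableLaw_cauchyMeasure.integral_abs_cpow one_pos hs hs1 hs2, Complex.ofReal_one,
    div_one, hpi, div_eq_div_iff
      (mul_ne_zero ofReal_sqrt_pi_ne_zero (Gamma_one_sub_div_two_ne_zero hs2))
      (mul_ne_zero ofReal_sqrt_pi_ne_zero ofReal_sqrt_pi_ne_zero)]
  linear_combination Complex.Gamma ((1 + s) / 2) * √Real.pi * two_cpow_mul_Gamma_one_sub s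

theorem IsSymmetricStableLaw.unique [IsFiniteMeasure ν] [IsFiniteMeasure ρ]
    (hν : IsSymmetricStableLaw ν α) (hρ : IsSymmetricStableLaw ρ α) : ν = ρ :=
  Measure.ext_of_charFun (funext fun t => (hν t).trans (hρ t).symm)

end Stable

theorem mainTheorem2 {Ω : Type*} [MeasurableSpace Ω] (μ : Measure Ω) [IsProbabilityMeasure μ]
    (α : ℝ) (hα0 : 0 < α) (hα2 : α ≤ 2) (S : Ω → ℝ) (hS : IsSymmetricStable S α μ) :
    (∀ᵐ ω ∂μ, S ω ≠ 0) ∧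
    (∀ s : ℂ, -1 < s.re → s.re < α →
      Integrable (fun ω => ((|S ω| : ℝ) : ℂ) ^ s) μ ∧
      ∫ ω, ((|S ω| : ℝ) : ℂ) ^ s ∂μ =
        2 ^ s * (Complex.Gamma ((1 + s) / 2) * Complex.Gamma (1 - s / (α : ℂ))) /
          ((Real.sqrt Real.pi : ℂ) * Complex.Gamma (1 - s / 2))) ∧
    (α = 1 →
      μ.map S = cauchyMeasure 0 1 ∧
      ∀ s : ℂ, -1 < s.re → s.re < 1 →
        ∫ ω, ((|S ω| : ℝ) : ℂ) ^ s ∂μ =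
          Complex.Gamma ((1 + s) / 2) * Complex.Gamma ((1 - s) / 2) / (Real.pi : ℂ) ∧
        ∫ ω, ((|S ω| : ℝ) : ℂ) ^ s ∂μ = 1 / Complex.cos ((Real.pi : ℂ) * s / 2)) := by
  have : IsProbabilityMeasure (μ.map S) := Measure.isProbabilityMeasure_map hS.1
  have hlaw : IsSymmetricStableLaw (μ.map S) α := hS.2
  have hmeas (s : ℂ) : Measurable fun x : ℝ => ((|x| : ℝ) : ℂ) ^ s := by fun_prop
  have hmap (s : ℂ) : ∫ x, ((|x| : ℝ) : ℂ) ^ s ∂μ.map S = ∫ ω, ((|S ω| : ℝ) : ℂ) ^ s ∂μ :=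
    integral_map hS.1 (hmeas s).aestronglyMeasurable
  refine ⟨ae_of_ae_map hS.1 (hlaw.ae_ne_zero hα0), fun s hs hsα => ⟨?_, ?_⟩, ?_⟩
  · exact (hlaw.integrable_abs_cpow hα0 hs hsα (hsα.trans_le hα2)).comp_aemeasurable hS.1
  · rw [← hmap, hlaw.integral_abs_cpow hα0 hs hsα (hsα.trans_le hα2)]
  · rintro rfl
    have hcauchy : μ.map S = cauchyMeasure 0 1 := hlaw.unique isSymmetricStableLaw_cauchyMeasure
    refine ⟨hcauchy, fun s hs hs1 => ?_⟩
    have hmoment := integral_abs_cpow_cauchyMeasure hs hs1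
    rw [← hcauchy, hmap] at hmoment
    refine ⟨hmoment, hmoment.trans ?_⟩
    rw [Gamma_one_add_div_two_mul_Gamma_one_sub_div_two,
      div_div_cancel_left' (Complex.ofReal_ne_zero.2 Real.pi_ne_zero), one_div]
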